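/- **Setting.** Let $w_0:[0,\infty)\to[0,\infty)$ be decreasing, integrable and right continuous at $0$, with $w_0(0)>0$. Let $X_0$ be the positive random variable with $P(X_0>x)=w_0(x)/w_0(0)$, let $\|X_0\|_\infty=\sup\{x: w_0(x)>0\}\in(0,\infty]$, and put $h_0(x)=\int_x^\infty w_0(y)\,dy$. When $h_0$ is $C^2$ on $[0,\|X_0\|_\infty)$, the *beta function* of $w_0$ is $$\beta_0(x)=\frac{h_0''(x)\,h_0(x)}{h_0'(x)^2},\qquad 0\le x<\|X_0\|_\infty .$$ A *solution of the LSW system with initial data $w_0$* is a function $w(x,t)$, $x\ge 0$, $t\ge 0$, with $w(\cdot,0)=w_0$, for which $$L(t)^{1/3}=\frac13\int_0^\infty x^{-2/3}w(x,t)\,dx\Big/w(0,t)$$ defines a positive continuous function $L$ on $[0,\infty)$, such that $\int_0^\infty w(x,t)\,dx=1$ for all $t\ge0$, and such that the equation $$\frac{\partial w}{\partial t}=\Big[1-\Big(\frac{x}{L(t)}\Big)^{1/3}\Big]\frac{\partial w}{\partial x}$$ holds in the sense of characteristics: $w(\xi(t),t)=w_0(\xi(0))$ for every $t>0$ and every continuous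 $\xi:[0,t]\to[0,\infty)$ with $\xi'(s)=-\big[1-(\xi(s)/L(s))^{1/3}\big]$ for $0<s<t$. Let $c(dx,t)=-d_xw(x,t)$ be the corresponding cluster density (a measure on $[0,\infty)$), and let $$\Lambda(t)=\int x\,c(dx,t)\Big/\int c(dx,t),\qquad E(t)=\int x^{2/3}\,c(dx,t).$$ **Proposition 4.2.** For every real $\beta_\infty$ there is a constant $C=C(\beta_\infty)>0$, depending only on $\beta_\infty$, with the following property. Suppose that $w_0$ is as above, that $L(0)=1$ (that is, $\frac13\int_0^\infty x^{-2/3}w_0(x)\,dx=w_0(0)$), and that $h_0$ is $C^2$ on $[0,\|X_0\|_\infty)$ with $\sup\beta_0\le\beta_\infty$. Let $w$ be a solution of the LSW system with initial data $w_0$. Then $$\Lambda(T)\le C\,T\qquad\text{and}\qquad \frac1{E(T)^3}\le C\,T\qquad\text{for all } T>1 .$$ -/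

import Mathlib

open MeasureTheory Set

namespace LSW

noncomputable section

/-- `h(x) = ∫ₓ^∞ w(y) dy`. -/
def tailIntegral (w : ℝ → ℝ) (x : ℝ) : ℝ := ∫ y in Ioi x, w y

/-- The interval `[0, ‖X‖_∞)`, where `‖X‖_∞ ∈ [0, ∞]` is the supremum of the points at which the
decreasing function `w` is positive, i.e. the essential supremum of the random variable `X` with
`P(X > x) = w(x) / w(0)`: for `x ≥ 0` one has `x < ‖X‖_∞` iff `w` is positive at some `y > x`. -/
def supportInterval (w : ℝ → ℝ) : Set ℝ := {x | 0 ≤ x ∧ ∃ y, x < y ∧ 0 < w y}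

/-- The beta function `β(x) = h''(x) h(x) / h'(x)²` of `w`, to be evaluated on `[0, ‖X‖_∞)`
(the derivatives are one-sided at `x = 0`). -/
def betaFun (w : ℝ → ℝ) (x : ℝ) : ℝ :=
  derivWithin (derivWithin (tailIntegral w) (Ici 0)) (Ici 0) x * tailIntegral w x /
    derivWithin (tailIntegral w) (Ici 0) x ^ 2

/-- `w` is a nonnegative decreasing integrable function on `[0, ∞)`; right continuity at `0` says
that the associated random variable `X` is positive (`P(X = 0) = 0`). Only the values of `w` on
`[0, ∞)` matter. -/
structure IsProfile (w : ℝ → ℝ) : Prop where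
  nonneg : ∀ x, 0 ≤ x → 0 ≤ w x
  antitone : AntitoneOn w (Ici 0)
  integrable : IntegrableOn w (Ioi 0)
  rightCont : ContinuousWithinAt w (Ici 0) 0

/-- `w` has a beta function (`h` is `C²` on `[0, ‖X‖_∞)`) and `sup β ≤ b`. -/
structure BetaBounded (w : ℝ → ℝ) (b : ℝ) : Prop where
  contDiff : ContDiffOn ℝ 2 (tailIntegral w) (supportInterval w)
  le : ∀ x ∈ supportInterval w, betaFun w x ≤ b

/-- The number `L` given by `L^{1/3} = (1/3) ∫₀^∞ x^{-2/3} w(x) dx / w(0)`. -/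
def typicalVolume (w : ℝ → ℝ) : ℝ :=
  ((1 / 3) * (∫ x in Ioi (0 : ℝ), x ^ (-(2 / 3) : ℝ) * w x) / w 0) ^ 3

/-- `ξ : [0, t] → [0, ∞)` is a characteristic of the LSW equation with parameter `L`:
`dξ/ds = -[1 - (ξ / L(s))^{1/3}]` for `0 < s < t`. -/
structure IsCharacteristic (L : ℝ → ℝ) (t : ℝ) (ξ : ℝ → ℝ) : Prop where
  cont : ContinuousOn ξ (Icc 0 t)
  nonneg : ∀ s ∈ Icc 0 t, 0 ≤ ξ s
  ode : ∀ s ∈ Ioo 0 t, HasDerivAt ξ (-(1 - (ξ s / L s) ^ (1 / 3 : ℝ))) s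

/-- `w(x,t)`, `x ≥ 0`, `t ≥ 0` (written `w t x`), is a solution of the LSW system
`∂w/∂t = [1 - (x/L(t))^{1/3}] ∂w/∂x`, `∫₀^∞ w(x,t) dx = 1`, with initial data `w₀`, where `L(t)` is
the typical volume of `w(·,t)`, a positive continuous function of `t`. The first order equation is
understood in the sense of characteristics (`w₀` may have a jump at the end of its support): the
solution is constant along every characteristic, i.e. `w(x,t) = w₀(F(x,t))` with `F(x,t) = ξ(0)` for
the characteristic `ξ` with `ξ(t) = x`. -/
structure IsSolution (w₀ : ℝ → ℝ) (w : ℝ → ℝ → ℝ) : Prop where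
  initial : ∀ x, 0 ≤ x → w 0 x = w₀ x
  pos : ∀ t, 0 ≤ t → 0 < typicalVolume (w t)
  cont : ContinuousOn (fun t => typicalVolume (w t)) (Ici 0)
  transport : ∀ t, 0 < t → ∀ ξ : ℝ → ℝ, IsCharacteristic (fun s => typicalVolume (w s)) t ξ →
    w t (ξ t) = w₀ (ξ 0)
  mass : ∀ t, 0 ≤ t → ∫ x in Ioi (0 : ℝ), w t x = 1

open Classical in
/-- The cluster density `c(dx)` on `[0, ∞)` with `∫_{(x,∞)} c(dx') = w(x)`, i.e. `c = -dw`: the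
Stieltjes measure of the increasing function `x ↦ -w(max x 0)`. (It is a measure and not always a
function because `w` may jump at the end of its support; for `w` that is not decreasing on `[0, ∞)`,
which does not occur for solutions, it is `0` by convention.) -/
def clusterMeasure (w : ℝ → ℝ) : Measure ℝ :=
  if h : Monotone (fun x => -w (max x 0)) then h.stieltjesFunction.measure else 0

/-- The mean cluster volume `Λ = ∫ x c(dx) / ∫ c(dx)`. -/
def meanVolume (w : ℝ → ℝ) : ℝ :=
  (∫ x, x ∂(clusterMeasure w)) / (clusterMeasure w).real univ

/-- The energy `E = ∫ x^{2/3} c(dx)`. -/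
def energy (w : ℝ → ℝ) : ℝ := ∫ x, x ^ (2 / 3 : ℝ) ∂(clusterMeasure w)

end

end LSW

namespace LSW

open Filter Topology

/-! With `h` the tail integral, `h' = -w`, so `β = (1/w)' h`. Integrating `(1/w)' ≤ b/h` over `[x,
y]`, where `h` is at least `h(y)`, gives `SlopeBound`. This derivative-free form passes from the
data to every later time (`SlopeBound.comp`), because a solution is the data composed with the
backward flow. That flow is increasing and convex: the velocity is increasing and concave in
position.

Normalise the mass to `1`. Characteristics move left at speed at most `1`, so `w(t+δ, 0) = w(t, p)`
for some `p ≤ δ`. For small `δ` the tail beyond `p` is at least `1/2`, and the slope bound gives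
`1/w(t+δ, 0) ≤ 1/w(t, 0) + 2bδ`. Summing over steps, `1/w(T, 0) ≤ 1/w₀(0) + 2bT`.

The slope bound also gives `w ≥ w(0)/(1+b)` on `[0, 1/(2w(0))]` (`SlopeBound.le`). At time `0`,
together with `L(0) = 1`, this bounds `1/w₀(0)`; at time `T` it gives `E³ ≥ w(T, 0)/(16(1+b)³)`.
Finally `Λ ≤ 1/w(T, 0)`. -/

/-! ### Characteristics -/

/-- A function that is nonincreasing wherever it is negative, and nonnegative at the right end of
an interval, is nonnegative on the interval. -/
lemma nonneg_of_deriv_nonpos_of_neg {t : ℝ} {φ φ' : ℝ → ℝ} (hc : ContinuousOn φ (Icc 0 t))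
    (hd : ∀ s ∈ Ioo 0 t, HasDerivAt φ (φ' s) s)
    (hneg : ∀ s ∈ Ioo 0 t, φ s < 0 → φ' s ≤ 0) (ht : 0 ≤ φ t) :
    ∀ s ∈ Icc 0 t, 0 ≤ φ s := by
  intro a ha
  by_contra! hlt
  -- Take the first point `σ` after `a` where `φ` is nonnegative. On `(a, σ)` the function is
  -- negative, hence nonincreasing, so `φ σ ≤ φ a < 0`, a contradiction.
  set Z : Set ℝ := Icc a t ∩ φ ⁻¹' Ici 0 with hZ
  have hca : ContinuousOn φ (Icc a t) := hc.mono (Icc_subset_Icc_left ha.1)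
  have hZc : IsClosed Z := hca.preimage_isClosed_of_isClosed isClosed_Icc isClosed_Ici
  have hZn : Z.Nonempty := ⟨t, ⟨ha.2, le_rfl⟩, ht⟩
  have hZb : BddBelow Z := ⟨a, fun x hx => hx.1.1⟩
  have hσ := hZc.csInf_mem hZn hZb
  set σ := sInf Z with hσdef
  have hb : ∀ s ∈ Ioo a σ, φ s < 0 := by
    intro s hs
    by_contra! h
    exact absurd (csInf_le hZb (⟨⟨hs.1.le, hs.2.le.trans hσ.1.2⟩, h⟩ : s ∈ Z)) (not_le.2 hs.2)
  have hmem : ∀ s ∈ Ioo a σ, s ∈ Ioo 0 t := fun s hs =>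
    ⟨ha.1.trans_lt hs.1, hs.2.trans_le hσ.1.2⟩
  have hanti : AntitoneOn φ (Icc a σ) := by
    apply antitoneOn_of_deriv_nonpos (convex_Icc a σ) (hca.mono (Icc_subset_Icc_right hσ.1.2))
    · rw [interior_Icc]
      exact fun s hs => (hd s (hmem s hs)).differentiableAt.differentiableWithinAt
    · rw [interior_Icc]
      intro s hs
      rw [(hd s (hmem s hs)).deriv]
      exact hneg s (hmem s hs) (hb s hs)
  have h1 := hanti (left_mem_Icc.2 hσ.1.1) (right_mem_Icc.2 hσ.1.1) hσ.1.1
  have h2 : 0 ≤ φ σ := hσ.2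
  linarith

/-- The velocity of characteristics is increasing in position. -/
lemma velocity_mono {l x y : ℝ} (hl : 0 < l) (hx : 0 ≤ x) (hxy : x ≤ y) :
    -(1 - (x / l) ^ (1 / 3 : ℝ)) ≤ -(1 - (y / l) ^ (1 / 3 : ℝ)) := by
  have : (x / l) ^ (1 / 3 : ℝ) ≤ (y / l) ^ (1 / 3 : ℝ) := by gcongr
  linarith

/-- The velocity of characteristics is concave in position. -/
lemma velocity_concave {l x y a b : ℝ} (hl : 0 < l) (hx : 0 ≤ x) (hy : 0 ≤ y) (ha : 0 ≤ a)
    (hb : 0 ≤ b) (hab : a + b = 1) :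
    a * -(1 - (x / l) ^ (1 / 3 : ℝ)) + b * -(1 - (y / l) ^ (1 / 3 : ℝ)) ≤
      -(1 - ((a * x + b * y) / l) ^ (1 / 3 : ℝ)) := by
  have h := (Real.concaveOn_rpow (p := 1 / 3) (by norm_num) (by norm_num)).2
    (show x / l ∈ Ici 0 from div_nonneg hx hl.le) (show y / l ∈ Ici 0 from div_nonneg hy hl.le)
    ha hb hab
  simp only [smul_eq_mul] at h
  have e : a * (x / l) + b * (y / l) = (a * x + b * y) / l := by ring
  rw [e] at h
  nlinarith

section

variable {L : ℝ → ℝ} {t : ℝ} {ξ η ζ : ℝ → ℝ}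

/-- Trajectories spread forward in time, so going backward they contract. Applied in both directions
this yields backward uniqueness, although the velocity is not Lipschitz at `0`. -/
lemma IsCharacteristic.mono (hL : ∀ s ∈ Icc 0 t, 0 < L s) (hξ : IsCharacteristic L t ξ)
    (hη : IsCharacteristic L t η) (h : ξ t ≤ η t) : ∀ s ∈ Icc 0 t, ξ s ≤ η s := by
  intro s hs
  have := nonneg_of_deriv_nonpos_of_neg (φ := fun s => η s - ξ s) (hη.cont.sub hξ.cont)
    (fun s hs => (hη.ode s hs).sub (hξ.ode s hs)) (fun s hs hlt => by
      have hs' := Ioo_subset_Icc_self hs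
      have := velocity_mono (hL s hs') (hη.nonneg s hs') (y := ξ s) (by simp at hlt; linarith)
      linarith) (by simpa using h) s hs
  simpa using this

lemma IsCharacteristic.sub_le (hL : ∀ s ∈ Icc 0 t, 0 < L s) (hξ : IsCharacteristic L t ξ)
    (hη : IsCharacteristic L t η) (h : ξ t ≤ η t) :
    ∀ s ∈ Icc 0 t, η s - ξ s ≤ η t - ξ t := by
  intro s hs
  have := nonneg_of_deriv_nonpos_of_neg (φ := fun s => (η t - ξ t) - (η s - ξ s))
    (continuousOn_const.sub (hη.cont.sub hξ.cont))
    (fun s hs => (((hη.ode s hs).sub (hξ.ode s hs)).const_sub _)) (fun s hs _ => by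
      have hs' := Ioo_subset_Icc_self hs
      have := velocity_mono (hL s hs') (hξ.nonneg s hs') (hξ.mono hL hη h s hs')
      linarith) (by simp) s hs
  linarith

/-- By concavity of the velocity, `a ξ + b ζ` moves no faster than a particle at its own position.
Followed backward from a common endpoint, it therefore stays above the true characteristic. At `s =
0` this is convexity of the backward flow. -/
lemma IsCharacteristic.convex (hL : ∀ s ∈ Icc 0 t, 0 < L s) (hξ : IsCharacteristic L t ξ)
    (hη : IsCharacteristic L t η) (hζ : IsCharacteristic L t ζ) {a b : ℝ} (ha : 0 ≤ a)
    (hb : 0 ≤ b) (hab : a + b = 1) (h : a * ξ t + b * ζ t = η t) :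
    ∀ s ∈ Icc 0 t, η s ≤ a * ξ s + b * ζ s := by
  intro s hs
  have := nonneg_of_deriv_nonpos_of_neg (φ := fun s => a * ξ s + b * ζ s - η s)
    (((hξ.cont.const_mul a).add (hζ.cont.const_mul b)).sub hη.cont)
    (fun s hs => (((hξ.ode s hs).const_mul a).add ((hζ.ode s hs).const_mul b)).sub (hη.ode s hs))
    (fun s hs hlt => by
      have hs' := Ioo_subset_Icc_self hs
      have h1 := velocity_concave (hL s hs') (hξ.nonneg s hs') (hζ.nonneg s hs') ha hb hab
      have h2 := velocity_mono (hL s hs')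
        (add_nonneg (mul_nonneg ha (hξ.nonneg s hs')) (mul_nonneg hb (hζ.nonneg s hs')))
        (y := η s) (by simp at hlt; linarith)
      linarith) (by simp [h]) s hs
  linarith

lemma IsCharacteristic.le_add (hL : ∀ s ∈ Icc 0 t, 0 < L s) (hξ : IsCharacteristic L t ξ) :
    ∀ s ∈ Icc 0 t, ξ s ≤ ξ t + (t - s) := by
  intro s hs
  have := nonneg_of_deriv_nonpos_of_neg (φ := fun s => ξ t + (t - s) - ξ s)
    (φ' := fun s => -1 - -(1 - (ξ s / L s) ^ (1 / 3 : ℝ)))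
    ((continuousOn_const.add (continuousOn_const.sub continuousOn_id)).sub hξ.cont)
    (fun s hs => (((hasDerivAt_id s).const_sub t).const_add (ξ t)).sub (hξ.ode s hs))
    (fun s hs _ => by
      have hs' := Ioo_subset_Icc_self hs
      have := Real.rpow_nonneg (div_nonneg (hξ.nonneg s hs') (hL s hs').le) (1 / 3)
      linarith) (by simp) s hs
  linarith

lemma IsCharacteristic.restrict (hξ : IsCharacteristic L t ξ) {s : ℝ} (hs : s ≤ t) :
    IsCharacteristic L s ξ :=
  ⟨hξ.cont.mono (Icc_subset_Icc_right hs), fun r hr => hξ.nonneg r ⟨hr.1, hr.2.trans hs⟩,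
    fun r hr => hξ.ode r ⟨hr.1, hr.2.trans_le hs⟩⟩

/-- Factor the difference of the cubes of `b^{1/3}` and `a^{1/3}`; the quadratic factor is at least
`d^{2/3}`. -/
lemma rpow_third_sub_le {d a b : ℝ} (hd : 0 < d) (hda : d ≤ a) (hab : a ≤ b) :
    b ^ (1 / 3 : ℝ) - a ^ (1 / 3 : ℝ) ≤
      ((d ^ (1 / 3 : ℝ)) ^ 2)⁻¹ * (b - a) := by
  have cube : ∀ z : ℝ, 0 ≤ z → (z ^ (1 / 3 : ℝ)) ^ 3 = z := fun z hz => by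
    rw [← Real.rpow_natCast, ← Real.rpow_mul hz]; norm_num
  have h0 : 0 < d ^ (1 / 3 : ℝ) := by positivity
  have h1 : d ^ (1 / 3 : ℝ) ≤ a ^ (1 / 3 : ℝ) := by gcongr
  have h2 : a ^ (1 / 3 : ℝ) ≤ b ^ (1 / 3 : ℝ) := by
    have := hd.le.trans hda
    gcongr
  have h3 := cube a (by linarith)
  have h4 := cube b (by linarith)
  set u := a ^ (1 / 3 : ℝ)
  set v := b ^ (1 / 3 : ℝ)
  set e := d ^ (1 / 3 : ℝ)
  rw [inv_mul_eq_div, le_div_iff₀ (by positivity), ← h3, ← h4]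
  have : e ^ 2 ≤ v ^ 2 + u * v + u ^ 2 := by nlinarith
  nlinarith [mul_le_mul_of_nonneg_left this (sub_nonneg.2 h2)]

end

lemma abs_rpow_third_sub_le {d a b : ℝ} (hd : 0 < d) (hda : d ≤ a) (hdb : d ≤ b) :
    |a ^ (1 / 3 : ℝ) - b ^ (1 / 3 : ℝ)| ≤ ((d ^ (1 / 3 : ℝ)) ^ 2)⁻¹ * |a - b| := by
  rcases le_total a b with h | h
  · have h1 : a ^ (1 / 3 : ℝ) ≤ b ^ (1 / 3 : ℝ) := by
      have := hd.le.trans hda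
      gcongr
    rw [abs_sub_comm, abs_sub_comm a, abs_of_nonneg (by linarith), abs_of_nonneg (by linarith)]
    exact rpow_third_sub_le hd hda h
  · have h1 : b ^ (1 / 3 : ℝ) ≤ a ^ (1 / 3 : ℝ) := by
      have := hd.le.trans hdb
      gcongr
    rw [abs_of_nonneg (by linarith), abs_of_nonneg (by linarith)]
    exact rpow_third_sub_le hd hdb h

/-! ### Existence of characteristics with a prescribed endpoint. -/

section

variable {L : ℝ → ℝ} {t : ℝ}

lemma exists_pos_le_of_continuousOn (ht : 0 < t) (hLc : ContinuousOn L (Icc 0 t))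
    (hL : ∀ s ∈ Icc 0 t, 0 < L s) : ∃ l, 0 < l ∧ ∀ s ∈ Icc 0 t, l ≤ L s := by
  obtain ⟨s, hs, hmin⟩ := isCompact_Icc.exists_isMinOn (nonempty_Icc.2 ht.le) hLc
  exact ⟨L s, hL s hs, hmin⟩

/-- Existence of characteristics ending at a positive point. -/
lemma exists_isCharacteristic_of_pos (ht : 0 < t) (hLc : ContinuousOn L (Icc 0 t))
    (hL : ∀ s ∈ Icc 0 t, 0 < L s) {x : ℝ} (hx : 0 < x) :
    ∃ ξ, IsCharacteristic L t ξ ∧ ξ t = x := by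
  obtain ⟨l, hl, hlL⟩ := exists_pos_le_of_continuousOn ht hLc hL
  -- Clipping positions to `[δ, M]` makes the velocity bounded and Lipschitz, so Picard–Lindelöf
  -- applies on all of `[0, t]`, started at the right end. The clip is never active: since `δ ≤ L`,
  -- the velocity at `δ` is at most `0`, and the velocity is never below `-1`.
  set δ := min x l with hδ
  have hδ0 : 0 < δ := lt_min hx hl
  set M := x + t with hM
  have hδM : δ ≤ M := (min_le_left _ _).trans (by linarith)
  set c : ℝ → ℝ := fun y => max δ (min y M) with hc
  have hcδ : ∀ y, δ ≤ c y := fun y => le_max_left _ _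
  have hcM : ∀ y, c y ≤ M := fun y => max_le hδM (min_le_right _ _)
  have hclip : ∀ y z, |c y - c z| ≤ |y - z| := fun y z => by
    refine (abs_max_sub_max_le_max _ _ _ _).trans ?_
    refine max_le (by simp) ((abs_min_sub_min_le_max _ _ _ _).trans (by simp))
  set f : ℝ → ℝ → ℝ := fun s y => -(1 - (c y / L s) ^ (1 / 3 : ℝ)) with hf
  set K : ℝ := ((δ ^ (1 / 3 : ℝ)) ^ 2)⁻¹ / l ^ (1 / 3 : ℝ) with hK
  have hK0 : 0 ≤ K := by positivity
  set B : ℝ := 1 + (M / l) ^ (1 / 3 : ℝ) with hB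
  have hM0 : 0 < M := by linarith
  have hB0 : 0 ≤ B := by positivity
  have hpl : IsPicardLindelof f (tmin := 0) (tmax := t) ⟨t, ht.le, le_rfl⟩ x
      (Real.toNNReal (B * t)) 0 (Real.toNNReal B) (Real.toNNReal K) := by
    refine ⟨fun s hs => ?_, fun y _ => ?_, fun s hs y _ => ?_, ?_⟩
    · refine LipschitzOnWith.of_dist_le_mul fun y _ z _ => ?_
      have hLs := hL s hs
      rw [Real.coe_toNNReal _ hK0, Real.dist_eq, Real.dist_eq]
      simp only [hf]
      rw [Real.div_rpow (hδ0.le.trans (hcδ y)) hLs.le, Real.div_rpow (hδ0.le.trans (hcδ z)) hLs.le]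
      have e : -(1 - c y ^ (1 / 3 : ℝ) / L s ^ (1 / 3 : ℝ)) -
          -(1 - c z ^ (1 / 3 : ℝ) / L s ^ (1 / 3 : ℝ)) =
          (c y ^ (1 / 3 : ℝ) - c z ^ (1 / 3 : ℝ)) / L s ^ (1 / 3 : ℝ) := by ring
      rw [e, abs_div, abs_of_nonneg (Real.rpow_nonneg hLs.le _), hK, div_mul_eq_mul_div]
      have h1 := abs_rpow_third_sub_le hδ0 (hcδ y) (hcδ z)
      have h2 := hclip y z
      have h3 := hlL s hs
      gcongr
      exact h1.trans (by gcongr)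
    · simp only [hf]
      refine (continuousOn_const.sub (ContinuousOn.rpow_const ?_ ?_)).neg
      · exact continuousOn_const.div hLc fun s hs => (hL s hs).ne'
      · exact fun s hs => Or.inr (by norm_num)
    · have hLs := hL s hs
      have h1 : 0 ≤ c y / L s := div_nonneg (hδ0.le.trans (hcδ y)) hLs.le
      have h2 : (c y / L s) ^ (1 / 3 : ℝ) ≤ (M / l) ^ (1 / 3 : ℝ) := by
        have := hcM y
        have := hlL s hs
        gcongr
      have h3 := Real.rpow_nonneg h1 (1 / 3)
      rw [Real.coe_toNNReal _ hB0, Real.norm_eq_abs, abs_le]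
      simp only [hf, hB]
      constructor <;> linarith
    · rw [Real.coe_toNNReal _ hB0, Real.coe_toNNReal _ (by positivity)]
      simp [ht.le]
  obtain ⟨ξ, hξt, hξ⟩ := hpl.exists_eq_forall_mem_Icc_hasDerivWithinAt₀
  have hcont : ContinuousOn ξ (Icc 0 t) := fun s hs => (hξ s hs).continuousWithinAt
  have hder : ∀ s ∈ Ioo 0 t, HasDerivAt ξ (f s (ξ s)) s := fun s hs =>
    (hξ s (Ioo_subset_Icc_self hs)).hasDerivAt (Icc_mem_nhds hs.1 hs.2)
  simp only at hξt
  have hlow : ∀ s ∈ Icc 0 t, δ ≤ ξ s := by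
    intro s hs
    have := nonneg_of_deriv_nonpos_of_neg (φ := fun s => ξ s - δ) (hcont.sub continuousOn_const)
      (fun s hs => (hder s hs).sub_const δ) (fun s hs hlt => by
        have hs' := Ioo_subset_Icc_self hs
        have hcs : c (ξ s) = δ := max_eq_left ((min_le_left _ _).trans (by simp at hlt; linarith))
        have : (δ / L s) ^ (1 / 3 : ℝ) ≤ 1 := by
          refine Real.rpow_le_one (by have := hL s hs'; positivity) ?_ (by norm_num)
          rw [div_le_one (hL s hs')]
          exact (min_le_right _ _).trans (hlL s hs')
        simp only [hf, hcs]
        linarith) (by simp [hξt, hδ]) s hs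
    linarith
  have hup : ∀ s ∈ Icc 0 t, ξ s ≤ x + (t - s) := by
    intro s hs
    have := nonneg_of_deriv_nonpos_of_neg (φ := fun s => x + (t - s) - ξ s)
      (φ' := fun s => -1 - f s (ξ s))
      ((continuousOn_const.add (continuousOn_const.sub continuousOn_id)).sub hcont)
      (fun s hs => (((hasDerivAt_id s).const_sub t).const_add x).sub (hder s hs))
      (fun s hs _ => by
        have hs' := Ioo_subset_Icc_self hs
        have := Real.rpow_nonneg (div_nonneg (hδ0.le.trans (hcδ (ξ s))) (hL s hs').le) (1 / 3)
        simp only [hf]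
        linarith) (by simp [hξt]) s hs
    linarith
  refine ⟨ξ, ⟨hcont, fun s hs => hδ0.le.trans (hlow s hs), fun s hs => ?_⟩, hξt⟩
  have hs' := Ioo_subset_Icc_self hs
  have hcs : c (ξ s) = ξ s := by
    simp only [hc]
    rw [min_eq_left (by linarith [hup s hs', hs'.1]), max_eq_right (hlow s hs')]
  have := hder s hs
  simp only [hf, hcs] at this
  exact this

/-- Subadditivity of the cube root. It serves near `0`, where no Lipschitz bound is available. -/
lemma abs_rpow_third_sub_le_rpow {a b : ℝ} (ha : 0 ≤ a) (hb : 0 ≤ b) :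
    |a ^ (1 / 3 : ℝ) - b ^ (1 / 3 : ℝ)| ≤ |a - b| ^ (1 / 3 : ℝ) := by
  wlog h : b ≤ a generalizing a b
  · rw [abs_sub_comm, abs_sub_comm a]
    exact this hb ha (le_of_not_ge h)
  have h1 : b ^ (1 / 3 : ℝ) ≤ a ^ (1 / 3 : ℝ) := by gcongr
  rw [abs_of_nonneg (by linarith), abs_of_nonneg (by linarith)]
  have := Real.rpow_add_le_add_rpow hb (sub_nonneg.2 h) (p := 1 / 3) (by norm_num) (by norm_num)
  rw [add_sub_cancel] at this
  linarith

/-- Existence of the characteristic ending at `0`, as a limit of those ending at positive points. -/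
lemma exists_isCharacteristic_zero (ht : 0 < t) (hLc : ContinuousOn L (Icc 0 t))
    (hL : ∀ s ∈ Icc 0 t, 0 < L s) :
    ∃ ξ, IsCharacteristic L t ξ ∧ ξ t = 0 := by
  obtain ⟨l, hl, hlL⟩ := exists_pos_le_of_continuousOn ht hLc hL
  set x : ℕ → ℝ := fun n => 1 / ((n : ℝ) + 1) with hxdef
  have hx0 : ∀ n, 0 < x n := fun n => Nat.one_div_pos_of_nat
  have hxlim : Tendsto x atTop (𝓝 0) := tendsto_one_div_add_atTop_nhds_zero_nat
  have hxanti : Antitone x := fun m n hmn => Nat.one_div_le_one_div hmn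
  choose ξ hξ hξt using fun n => exists_isCharacteristic_of_pos ht hLc hL (hx0 n)
  have hanti : ∀ s ∈ Icc 0 t, ∀ m n, m ≤ n → ξ n s ≤ ξ m s := fun s hs m n hmn =>
    (hξ n).mono hL (hξ m) (by rw [hξt, hξt]; exact hxanti hmn) s hs
  have hlim : ∀ s ∈ Icc 0 t, Tendsto (fun n => ξ n s) atTop (𝓝 (⨅ n, ξ n s)) := fun s hs =>
    tendsto_atTop_ciInf (fun m n hmn => hanti s hs m n hmn)
      ⟨0, by rintro _ ⟨n, rfl⟩; exact (hξ n).nonneg s hs⟩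
  set η : ℝ → ℝ := fun s => ⨅ n, ξ n s with hη
  have hle : ∀ s ∈ Icc 0 t, ∀ n, η s ≤ ξ n s := fun s hs n =>
    ciInf_le ⟨0, by rintro _ ⟨n, rfl⟩; exact (hξ n).nonneg s hs⟩ n
  have hnn : ∀ s ∈ Icc 0 t, 0 ≤ η s := fun s hs => le_ciInf fun n => (hξ n).nonneg s hs
  -- Backward contraction: gaps at time `s` are at most the gaps at time `t`, so the convergence is
  -- uniform.
  have hdist : ∀ s ∈ Icc 0 t, ∀ n, ξ n s - η s ≤ x n := fun s hs n => by
    refine le_of_tendsto (tendsto_const_nhds.sub (hlim s hs)) ?_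
    filter_upwards [eventually_ge_atTop n] with m hm
    have := (hξ m).sub_le hL (hξ n) (by rw [hξt, hξt]; exact hxanti hm) s hs
    rw [hξt, hξt] at this
    linarith [hx0 m]
  have habs : ∀ s ∈ Icc 0 t, ∀ n, |ξ n s - η s| ≤ x n := fun s hs n => by
    rw [abs_of_nonneg (sub_nonneg.2 (hle s hs n))]
    exact hdist s hs n
  refine ⟨η, ⟨?_, hnn, ?_⟩, ?_⟩
  · have hu : TendstoUniformlyOn ξ η atTop (Icc 0 t) := by
      rw [Metric.tendstoUniformlyOn_iff]
      intro ε hε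
      filter_upwards [hxlim.eventually (gt_mem_nhds hε)] with n hn s hs
      rw [dist_comm, Real.dist_eq]
      exact (habs s hs n).trans_lt hn
    exact hu.continuousOn (Frequently.of_forall fun n => (hξ n).cont)
  · intro s hs
    refine hasDerivAt_of_tendstoUniformlyOn (f := ξ) (l := atTop)
      (f' := fun n s => -(1 - (ξ n s / L s) ^ (1 / 3 : ℝ)))
      (g' := fun s => -(1 - (η s / L s) ^ (1 / 3 : ℝ))) isOpen_Ioo ?_
      (Eventually.of_forall fun n s hs => (hξ n).ode s hs)
      (fun s hs => hlim s (Ioo_subset_Icc_self hs)) hs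
    rw [Metric.tendstoUniformlyOn_iff]
    intro ε hε
    have hlim2 : Tendsto (fun n => (x n / l) ^ (1 / 3 : ℝ)) atTop (𝓝 0) := by
      have h1 : Tendsto (fun n => x n / l) atTop (𝓝 0) := by simpa using hxlim.div_const l
      have := h1.rpow_const (p := 1 / 3) (Or.inr (by norm_num))
      rwa [Real.zero_rpow (by norm_num)] at this
    filter_upwards [hlim2.eventually (gt_mem_nhds hε)] with n hn s hs
    have hs' := Ioo_subset_Icc_self hs
    have hLs := hL s hs'
    refine lt_of_le_of_lt ?_ hn
    rw [dist_comm, Real.dist_eq]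
    have e : ∀ a b : ℝ, -(1 - a) - -(1 - b) = a - b := fun a b => by ring
    rw [e]
    refine (abs_rpow_third_sub_le_rpow (div_nonneg ((hξ n).nonneg s hs') hLs.le)
      (div_nonneg (hnn s hs') hLs.le)).trans ?_
    rw [← sub_div, abs_div, abs_of_pos hLs]
    have h1 := habs s hs' n
    have h2 := hlL s hs'
    have h3 := (hx0 n).le
    gcongr
  · have h1 : Tendsto (fun n => ξ n t) atTop (𝓝 (η t)) := hlim t (right_mem_Icc.2 ht.le)
    exact tendsto_nhds_unique h1 (by simpa only [hξt] using hxlim)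

/-- Through every point of `[0, ∞)` at time `t` there is a characteristic. -/
lemma exists_isCharacteristic (ht : 0 < t) (hLc : ContinuousOn L (Icc 0 t))
    (hL : ∀ s ∈ Icc 0 t, 0 < L s) {x : ℝ} (hx : 0 ≤ x) :
    ∃ ξ, IsCharacteristic L t ξ ∧ ξ t = x := by
  rcases hx.eq_or_lt with rfl | hx
  · exact exists_isCharacteristic_zero ht hLc hL
  · exact exists_isCharacteristic_of_pos ht hLc hL hx

end

/-! ### An integrated form of the bound on the beta function -/

/-- The bound `β ≤ b`, i.e. `(1 / w)' ≤ b / h`, in a form that does not refer to derivatives. -/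
def SlopeBound (b : ℝ) (w : ℝ → ℝ) : Prop :=
  ∀ x y, 0 ≤ x → x < y → 0 < w y → ((w y)⁻¹ - (w x)⁻¹) * tailIntegral w y ≤ b * (y - x)

section

variable {w v : ℝ → ℝ} {x y b β : ℝ}

lemma tailIntegral_nonneg (hw : ∀ z, 0 ≤ z → 0 ≤ w z) (hx : 0 ≤ x) : 0 ≤ tailIntegral w x :=
  setIntegral_nonneg measurableSet_Ioi fun z hz => hw z (hx.trans (le_of_lt hz))

lemma tailIntegral_sub (hi : IntegrableOn w (Ioi 0)) (hx : 0 ≤ x) (hxy : x ≤ y) :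
    tailIntegral w x - tailIntegral w y = ∫ z in x..y, w z :=
  intervalIntegral.integral_Ioi_sub_Ioi' (hi.mono_set (Ioi_subset_Ioi hx))
    (hi.mono_set (Ioi_subset_Ioi (hx.trans hxy)))

lemma intervalIntegrable_of_integrableOn_Ioi (hi : IntegrableOn w (Ioi 0)) (hx : 0 ≤ x)
    (hxy : x ≤ y) : IntervalIntegrable w volume x y := by
  rw [intervalIntegrable_iff_integrableOn_Ioc_of_le hxy]
  exact hi.mono_set fun z hz => hx.trans_lt hz.1

lemma tailIntegral_sub_le (ha : AntitoneOn w (Ici 0)) (hi : IntegrableOn w (Ioi 0)) (hx : 0 ≤ x)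
    (hxy : x ≤ y) : tailIntegral w x - tailIntegral w y ≤ w x * (y - x) := by
  rw [tailIntegral_sub hi hx hxy]
  have := intervalIntegral.integral_mono_on hxy (intervalIntegrable_of_integrableOn_Ioi hi hx hxy)
    (intervalIntegrable_const (c := w x)) fun z hz => ha hx (hx.trans hz.1) hz.1
  simpa [mul_comm] using this

lemma le_tailIntegral_sub (ha : AntitoneOn w (Ici 0)) (hi : IntegrableOn w (Ioi 0)) (hx : 0 ≤ x)
    (hxy : x ≤ y) : w y * (y - x) ≤ tailIntegral w x - tailIntegral w y := by
  rw [tailIntegral_sub hi hx hxy]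
  have := intervalIntegral.integral_mono_on hxy (intervalIntegrable_const (c := w y))
    (intervalIntegrable_of_integrableOn_Ioi hi hx hxy) fun z hz => ha (hx.trans hz.1)
      (hx.trans hxy) hz.2
  simpa [mul_comm] using this

lemma exists_gt_of_tailIntegral_pos (h : 0 < tailIntegral w x) : ∃ y, x < y ∧ 0 < w y := by
  by_contra! hc
  have : tailIntegral w x ≤ 0 := setIntegral_nonpos measurableSet_Ioi hc
  linarith

lemma IsProfile.pos_of_mem (hw : IsProfile w) (hx : x ∈ supportInterval w) : 0 < w x := by
  obtain ⟨h0, y, hxy, hy⟩ := hx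
  exact hy.trans_le (hw.antitone h0 (h0.trans hxy.le) hxy.le)

/-- The support interval is relatively open in `[0, ∞)`, so derivatives within it agree with those
in `betaFun`. -/
lemma supportInterval_eventuallyEq (hx : x ∈ supportInterval w) :
    supportInterval w =ᶠ[𝓝 x] Ici 0 := by
  obtain ⟨h0, y, hxy, hy⟩ := hx
  filter_upwards [Iio_mem_nhds hxy] with z hz
  exact propext ⟨fun h => h.1, fun h => ⟨h, y, hz, hy⟩⟩

lemma uniqueDiffOn_supportInterval : UniqueDiffOn ℝ (supportInterval w) := fun x hx =>
  (uniqueDiffOn_Ici 0 x hx.1).mono_nhds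
    (nhdsWithin_eq_iff_eventuallyEq.2 (supportInterval_eventuallyEq hx)).ge

lemma derivWithin_supportInterval (f : ℝ → ℝ) (hx : x ∈ supportInterval w) :
    derivWithin f (supportInterval w) x = derivWithin f (Ici 0) x :=
  derivWithin_congr_set (supportInterval_eventuallyEq hx)

/-- A differentiable tail integral of a decreasing function `w` has derivative `-w`. -/
lemma IsProfile.derivWithin_tailIntegral (hw : IsProfile w) (hx : 0 ≤ x)
    (hd : DifferentiableWithinAt ℝ (tailIntegral w) (Ici 0) x) :
    derivWithin (tailIntegral w) (Ici 0) x = -w x := by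
  have hd' := hd.hasDerivWithinAt
  set d := derivWithin (tailIntegral w) (Ici 0) x
  have hr : Tendsto (slope (tailIntegral w) x) (𝓝[>] x) (𝓝 d) :=
    hasDerivWithinAt_iff_tendsto_slope' (lt_irrefl x) |>.1
      (hd'.mono (Ioi_subset_Ici_self.trans (Ici_subset_Ici.2 hx)))
  apply le_antisymm
  -- Left difference quotients are at most `-w x`. None exist at `0`, where right quotients and
  -- right continuity replace them.
  · rcases hx.eq_or_lt with rfl | hx
    · have hc : Tendsto (fun y => -w y) (𝓝[>] 0) (𝓝 (-w 0)) :=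
        (hw.rightCont.mono Ioi_subset_Ici_self).neg
      refine le_of_tendsto_of_tendsto hr hc ?_
      filter_upwards [self_mem_nhdsWithin] with y (hy : 0 < y)
      have := le_tailIntegral_sub hw.antitone hw.integrable le_rfl hy.le
      rw [slope_def_field, div_le_iff₀ (by linarith)]
      linarith
    · have hl : Tendsto (slope (tailIntegral w) x) (𝓝[<] x) (𝓝 d) :=
        hasDerivWithinAt_iff_tendsto_slope' (s := Iio x) (lt_irrefl x) |>.1
          (hd'.hasDerivAt (Ici_mem_nhds hx)).hasDerivWithinAt
      refine le_of_tendsto hl ?_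
      filter_upwards [self_mem_nhdsWithin, mem_nhdsWithin_of_mem_nhds (Ioi_mem_nhds hx)] with y
        (hy : y < x) (hy0 : 0 < y)
      have := le_tailIntegral_sub hw.antitone hw.integrable hy0.le hy.le
      rw [slope_comm, slope_def_field, div_le_iff₀ (by linarith)]
      linarith
  · refine ge_of_tendsto hr ?_
    filter_upwards [self_mem_nhdsWithin] with y (hy : x < y)
    have := tailIntegral_sub_le hw.antitone hw.integrable hx hy.le
    rw [slope_def_field, le_div_iff₀ (by linarith)]
    linarith

lemma BetaBounded.slopeBound (hw : IsProfile w) (hβ : BetaBounded w β) (hb : 0 ≤ b)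
    (hβb : β ≤ b) : SlopeBound b w := by
  intro x y hx hxy _
  -- `y` may be the end of the support, where `w` can still be positive but the tail vanishes; the
  -- bound is then trivial.
  rcases (tailIntegral_nonneg hw.nonneg (hx.trans hxy.le)).eq_or_lt with h0 | hpos
  · rw [← h0, mul_zero]
    exact mul_nonneg hb (by linarith)
  set S := supportInterval w with hS
  obtain ⟨z, hyz, hz⟩ := exists_gt_of_tailIntegral_pos hpos
  have hyS : y ∈ S := ⟨hx.trans hxy.le, z, hyz, hz⟩
  have hsub : Icc x y ⊆ S := fun s hs => ⟨hx.trans hs.1, z, hs.2.trans_lt hyz, hz⟩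
  have hG : EqOn (derivWithin (tailIntegral w) S) (fun s => -w s) S := fun s hs => by
    rw [derivWithin_supportInterval _ hs]
    refine hw.derivWithin_tailIntegral hs.1 ?_
    exact (differentiableWithinAt_congr_set (supportInterval_eventuallyEq hs)).1
      (hβ.contDiff.differentiableOn (by norm_num) s hs)
  have hwd : DifferentiableOn ℝ (fun s => -w s) S :=
    ((hβ.contDiff.derivWithin (m := 1) uniqueDiffOn_supportInterval (by norm_num)).differentiableOn
      (by norm_num)).congr fun s hs => (hG hs).symm
  have hder2 : ∀ s ∈ S, derivWithin (derivWithin (tailIntegral w) (Ici 0)) (Ici 0) s =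
      derivWithin (fun s => -w s) S s := fun s hs => by
    rw [← derivWithin_supportInterval _ hs]
    refine derivWithin_congr (fun r hr => ?_) ?_
    · exact (derivWithin_supportInterval _ hr).symm.trans (hG hr)
    · exact (derivWithin_supportInterval _ hs).symm.trans (hG hs)
  have hderw : ∀ s ∈ Ioo x y, HasDerivAt (fun s => (w s)⁻¹)
      (derivWithin (fun s => -w s) S s / w s ^ 2) s := by
    intro s hs
    have hsS := hsub (Ioo_subset_Icc_self hs)
    have hn : S ∈ 𝓝 s := mem_of_superset (Icc_mem_nhds hs.1 hs.2) hsub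
    have h1 := ((hwd s hsS).hasDerivWithinAt.hasDerivAt hn).fun_neg
    simp only [neg_neg] at h1
    simpa using h1.fun_inv (hw.pos_of_mem hsS).ne'
  have hc : ContinuousOn (fun s => (w s)⁻¹) (Icc x y) := by
    have h1 : ContinuousOn w (Icc x y) := by
      simpa using (hwd.mono hsub).continuousOn.fun_neg
    exact h1.inv₀ fun s hs => (hw.pos_of_mem (hsub hs)).ne'
  have key := (convex_Icc x y).image_sub_le_mul_sub_of_deriv_le (C := b / tailIntegral w y) hc
    (by rw [interior_Icc]; exact fun s hs => (hderw s hs).differentiableAt.differentiableWithinAt)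
    (by
      rw [interior_Icc]
      intro s hs
      have hsS := hsub (Ioo_subset_Icc_self hs)
      have hws := hw.pos_of_mem hsS
      have h1 := (hβ.le s hsS).trans hβb
      rw [betaFun, hder2 s hsS, ← derivWithin_supportInterval _ hsS, hG hsS, neg_sq,
        div_le_iff₀ (by positivity)] at h1
      have h2 : tailIntegral w y ≤ tailIntegral w s := by
        have := le_tailIntegral_sub hw.antitone hw.integrable hsS.1 hs.2.le
        have := mul_nonneg (hw.nonneg y hyS.1) (sub_nonneg.2 hs.2.le)
        linarith
      rw [(hderw s hs).deriv]
      have hs0 : 0 < tailIntegral w s := hpos.trans_le h2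
      calc _ ≤ b / tailIntegral w s := by
            rw [div_le_div_iff₀ (by positivity) hs0]
            exact h1
        _ ≤ _ := by gcongr) x ⟨le_rfl, hxy.le⟩ y ⟨hxy.le, le_rfl⟩ hxy.le
  rw [div_mul_eq_mul_div, le_div_iff₀ hpos] at key
  exact key

/-- The slope bound is inherited by compositions with increasing convex maps. -/
lemma SlopeBound.comp (hw : IsProfile w) (hs : SlopeBound b w) (hb : 0 ≤ b) {F : ℝ → ℝ}
    (hF0 : ∀ z, 0 ≤ z → 0 ≤ F z) (hFm : MonotoneOn F (Ici 0)) (hFc : ConvexOn ℝ (Ici 0) F)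
    (hv : ∀ z, 0 ≤ z → v z = w (F z)) : SlopeBound b v := by
  intro x y hx hxy hvy
  have hy : 0 ≤ y := hx.trans hxy.le
  have hxy' : 0 < y - x := sub_pos.2 hxy
  rw [hv x hx, hv y hy]
  rcases (hFm hx hy hxy.le).eq_or_lt with heq | hlt
  · rw [heq, sub_self, zero_mul]
    exact mul_nonneg hb hxy'.le
  -- Beyond `y` the convex `F` lies above its secant through `x` and `y`. Replacing `F` by this line
  -- of slope `k` costs a factor `1/k` in the tail integral, which cancels against `F y - F x = k (y
  -- - x)`.
  set k := (F y - F x) / (y - x) with hk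
  have hk0 : 0 < k := div_pos (sub_pos.2 hlt) hxy'
  set J := (Ioi (F y)).indicator w with hJ
  have hJi : Integrable J :=
    (hw.integrable.mono_set (Ioi_subset_Ioi (hF0 y hy))).integrable_indicator measurableSet_Ioi
  have hJi2 : Integrable fun s => J (k * s + (F y - k * y)) :=
    (hJi.comp_add_right (F y - k * y)).comp_mul_left' hk0.ne'
  have hint : ∫ s, J (k * s + (F y - k * y)) = k⁻¹ * tailIntegral w (F y) := by
    rw [Measure.integral_comp_mul_left (fun u => J (u + (F y - k * y))) k,
      integral_add_right_eq_self J, abs_of_pos (inv_pos.2 hk0), smul_eq_mul, hJ,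
      integral_indicator measurableSet_Ioi, tailIntegral]
  have hJ0 : ∀ u, 0 ≤ J u := fun u =>
    indicator_nonneg (fun z hz => hw.nonneg z ((hF0 y hy).trans (le_of_lt hz))) u
  have htail : tailIntegral v y ≤ k⁻¹ * tailIntegral w (F y) := by
    rw [← hint, tailIntegral, ← integral_indicator measurableSet_Ioi]
    refine integral_mono_of_nonneg (Eventually.of_forall fun s => ?_) hJi2
      (Eventually.of_forall fun s => ?_)
    · refine indicator_nonneg (fun z (hz : y < z) => ?_) s
      rw [hv z (hy.trans hz.le)]
      exact hw.nonneg _ (hF0 z (hy.trans hz.le))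
    · by_cases hys : y < s
      · have hs0 : 0 ≤ s := hy.trans hys.le
        have h1 := hFc.slope_mono_adjacent (x := x) (y := y) (z := s) hx hs0 hxy hys
        rw [← hk, le_div_iff₀ (sub_pos.2 hys)] at h1
        have h2 : F y < k * s + (F y - k * y) := by nlinarith
        have h3 : J (k * s + (F y - k * y)) = w (k * s + (F y - k * y)) :=
          indicator_of_mem (show _ ∈ Ioi (F y) from h2) w
        simp only [h3]
        rw [indicator_of_mem (show s ∈ Ioi y from hys), hv s hs0]
        exact hw.antitone ((hF0 y hy).trans h2.le) (hF0 s hs0) (by linarith)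
      · rw [indicator_of_notMem (show s ∉ Ioi y from hys)]
        exact hJ0 _
  have h4 := hs (F x) (F y) (hF0 x hx) hlt (by rwa [← hv y hy])
  have hFx := hF0 x hx
  have h5 : 0 ≤ (w (F y))⁻¹ - (w (F x))⁻¹ := by
    rw [sub_nonneg]
    have := hw.antitone hFx (hF0 y hy) hlt.le
    rw [hv y hy] at hvy
    gcongr
  calc _ ≤ ((w (F y))⁻¹ - (w (F x))⁻¹) * (k⁻¹ * tailIntegral w (F y)) := by gcongr
    _ = k⁻¹ * (((w (F y))⁻¹ - (w (F x))⁻¹) * tailIntegral w (F y)) := by ring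
    _ ≤ k⁻¹ * (b * (F y - F x)) := by gcongr
    _ = b * (y - x) := by
      rw [hk]
      have := (sub_pos.2 hlt).ne'
      field_simp

/-- The slope bound prevents `w` from decreasing quickly. -/
lemma SlopeBound.le (hs : SlopeBound b w) (ha : AntitoneOn w (Ici 0))
    (hi : IntegrableOn w (Ioi 0)) (hb : 0 ≤ b) (hw0 : 0 < w 0)
    (hx : 0 ≤ x) (hxh : x ≤ tailIntegral w 0 / (2 * w 0)) : w 0 / (1 + b) ≤ w x := by
  rcases hx.eq_or_lt with rfl | hx0
  · exact div_le_self hw0.le (by linarith)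
  have h1 := tailIntegral_sub_le ha hi le_rfl hx
  rw [le_div_iff₀ (by positivity)] at hxh
  have h2 : 0 < tailIntegral w x := by nlinarith
  obtain ⟨z, hxz, hz⟩ := exists_gt_of_tailIntegral_pos h2
  have hwx : 0 < w x := hz.trans_le (ha hx (hx.trans hxz.le) hxz.le)
  have h3 := hs 0 x le_rfl hx0 hwx
  have h4 : 0 ≤ (w x)⁻¹ - (w 0)⁻¹ := by
    rw [sub_nonneg]
    have := ha self_mem_Ici hx hx
    gcongr
  -- Both `w 0 * x` and the mass lost up to `x` are at most half the total mass.
  have h5 : w 0 * x ≤ tailIntegral w x := by nlinarith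
  have h6 : ((w x)⁻¹ - (w 0)⁻¹) * (w 0 * x) ≤ b * x :=
    (mul_le_mul_of_nonneg_left h5 h4).trans (by simpa using h3)
  have h7 : ((w x)⁻¹ - (w 0)⁻¹) * w 0 ≤ b := by
    rw [← mul_assoc] at h6
    exact le_of_mul_le_mul_right h6 hx0
  rw [sub_mul, inv_mul_cancel₀ hw0.ne', inv_mul_eq_div, sub_le_iff_le_add, div_le_iff₀ hwx] at h7
  rw [div_le_iff₀ (by linarith)]
  linarith

end

/-! ### Solutions -/

section

variable {w₀ : ℝ → ℝ} {w : ℝ → ℝ → ℝ} {t b : ℝ}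

/-- A solution at time `t` is the composition of the initial data with an increasing convex map. -/
lemma IsSolution.exists_backward_flow (hw : IsSolution w₀ w) (ht : 0 ≤ t) :
    ∃ F : ℝ → ℝ, (∀ x, 0 ≤ x → 0 ≤ F x) ∧ MonotoneOn F (Ici 0) ∧ ConvexOn ℝ (Ici 0) F ∧
      ∀ x, 0 ≤ x → w t x = w₀ (F x) := by
  rcases ht.eq_or_lt with rfl | ht
  · exact ⟨id, fun _ h => h, monotoneOn_id, convexOn_id (convex_Ici 0), hw.initial⟩
  have hL : ∀ s ∈ Icc 0 t, 0 < typicalVolume (w s) := fun s hs => hw.pos s hs.1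
  have hLc : ContinuousOn (fun s => typicalVolume (w s)) (Icc 0 t) :=
    hw.cont.mono Icc_subset_Ici_self
  have h0 : (0 : ℝ) ∈ Icc 0 t := ⟨le_rfl, ht.le⟩
  have hex : ∀ x : ℝ, 0 ≤ x →
      ∃ ξ, IsCharacteristic (fun s => typicalVolume (w s)) t ξ ∧ ξ t = x :=
    fun x hx => exists_isCharacteristic ht hLc hL hx
  choose! ξ hξ hξt using hex
  refine ⟨fun x => ξ x 0, fun x hx => (hξ x hx).nonneg 0 h0, fun x hx y hy hxy => ?_,
    ⟨convex_Ici 0, fun x hx y hy a b ha hb hab => ?_⟩, fun x hx => ?_⟩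
  · exact (hξ x hx).mono hL (hξ y hy) (by rwa [hξt x hx, hξt y hy]) 0 h0
  · have hxy : 0 ≤ a • x + b • y := add_nonneg (mul_nonneg ha hx) (mul_nonneg hb hy)
    exact (hξ x hx).convex hL (hξ _ hxy) (hξ y hy) ha hb hab
      (by rw [hξt x hx, hξt _ hxy, hξt y hy, smul_eq_mul, smul_eq_mul]) 0 h0
  · have := hw.transport t ht _ (hξ x hx)
    rwa [hξt x hx] at this

lemma IsSolution.nonneg (hw : IsSolution w₀ w) (hw₀ : IsProfile w₀) (ht : 0 ≤ t) :
    ∀ x, 0 ≤ x → 0 ≤ w t x := by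
  obtain ⟨F, hF0, -, -, hF⟩ := hw.exists_backward_flow ht
  intro x hx
  rw [hF x hx]
  exact hw₀.nonneg _ (hF0 x hx)

lemma IsSolution.antitoneOn (hw : IsSolution w₀ w) (hw₀ : IsProfile w₀) (ht : 0 ≤ t) :
    AntitoneOn (w t) (Ici 0) := by
  obtain ⟨F, hF0, hFm, -, hF⟩ := hw.exists_backward_flow ht
  intro x hx y hy hxy
  rw [hF x hx, hF y hy]
  exact hw₀.antitone (hF0 x hx) (hF0 y hy) (hFm hx hy hxy)

lemma IsSolution.slopeBound (hw : IsSolution w₀ w) (hw₀ : IsProfile w₀) (hb : 0 ≤ b)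
    (hs : SlopeBound b w₀) (ht : 0 ≤ t) : SlopeBound b (w t) := by
  obtain ⟨F, hF0, hFm, hFc, hF⟩ := hw.exists_backward_flow ht
  exact hs.comp hw₀ hb hF0 hFm hFc hF

lemma IsSolution.integrableOn (hw : IsSolution w₀ w) (ht : 0 ≤ t) :
    IntegrableOn (w t) (Ioi 0) := by
  -- A nonintegrable function has integral `0` by convention, not `1`.
  by_contra h
  exact one_ne_zero ((hw.mass t ht).symm.trans (integral_undef h))

lemma IsSolution.tailIntegral_zero (hw : IsSolution w₀ w) (ht : 0 ≤ t) :
    tailIntegral (w t) 0 = 1 := hw.mass t ht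

lemma IsSolution.apply_zero_pos (hw : IsSolution w₀ w) (hw₀ : IsProfile w₀) (ht : 0 ≤ t) :
    0 < w t 0 := by
  refine (hw.nonneg hw₀ ht 0 le_rfl).lt_of_ne fun h => ?_
  have := hw.pos t ht
  -- Division by zero would make the typical volume `0`.
  simp [typicalVolume, ← h] at this

lemma IsSolution.apply_zero_le (hw : IsSolution w₀ w) (hw₀ : IsProfile w₀) (ht : 0 ≤ t) :
    w t 0 ≤ w₀ 0 := by
  obtain ⟨F, hF0, -, -, hF⟩ := hw.exists_backward_flow ht
  rw [hF 0 le_rfl]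
  exact hw₀.antitone self_mem_Ici (hF0 0 le_rfl) (hF0 0 le_rfl)

/-- The value at the origin at a later time is the present value at a nearby point. -/
lemma IsSolution.exists_apply_eq_apply_zero (hw : IsSolution w₀ w) (ht : 0 ≤ t) {δ : ℝ}
    (hδ : 0 < δ) : ∃ p, 0 ≤ p ∧ p ≤ δ ∧ w t p = w (t + δ) 0 := by
  have hL : ∀ s ∈ Icc 0 (t + δ), 0 < typicalVolume (w s) := fun s hs => hw.pos s hs.1
  have hLc : ContinuousOn (fun s => typicalVolume (w s)) (Icc 0 (t + δ)) :=
    hw.cont.mono Icc_subset_Ici_self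
  obtain ⟨ξ, hξ, hξt⟩ := exists_isCharacteristic (by linarith) hLc hL le_rfl
  have htm : t ∈ Icc 0 (t + δ) := ⟨ht, by linarith⟩
  refine ⟨ξ t, hξ.nonneg t htm, ?_, ?_⟩
  · have := hξ.le_add hL t htm
    linarith
  · rw [← hξt, hw.transport (t + δ) (by linarith) ξ hξ]
    rcases ht.eq_or_lt with rfl | ht
    · exact hw.initial _ (hξ.nonneg 0 htm)
    · exact hw.transport t ht ξ (hξ.restrict (by linarith))

lemma IsSolution.inv_apply_zero_add_le (hw : IsSolution w₀ w) (hw₀ : IsProfile w₀) (hb : 0 ≤ b)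
    (hs : SlopeBound b w₀) (ht : 0 ≤ t) {δ : ℝ} (hδ : 0 < δ) (hδw : δ * w₀ 0 ≤ 1 / 2) :
    (w (t + δ) 0)⁻¹ ≤ (w t 0)⁻¹ + 2 * b * δ := by
  obtain ⟨p, hp, hpδ, hpw⟩ := hw.exists_apply_eq_apply_zero ht hδ
  rw [← hpw]
  rcases hp.eq_or_lt with rfl | hp
  · have : 0 ≤ 2 * b * δ := by positivity
    linarith
  have hpos : 0 < w t p := hpw ▸ hw.apply_zero_pos hw₀ (by linarith : 0 ≤ t + δ)
  have h1 := hw.slopeBound hw₀ hb hs ht 0 p le_rfl hp hpos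
  have h2 := tailIntegral_sub_le (hw.antitoneOn hw₀ ht) (hw.integrableOn ht) le_rfl hp.le
  have h3 := hw.apply_zero_le hw₀ ht
  have h4 := hw.apply_zero_pos hw₀ ht
  rw [hw.tailIntegral_zero ht] at h2
  have h5 : w t 0 * p ≤ w₀ 0 * δ := mul_le_mul h3 hpδ hp.le (h4.le.trans h3)
  have h6 : 1 / 2 ≤ tailIntegral (w t) p := by linarith
  have h7 : 0 ≤ (w t p)⁻¹ - (w t 0)⁻¹ := by
    rw [sub_nonneg]
    have := hw.antitoneOn hw₀ ht self_mem_Ici hp.le hp.le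
    gcongr
  have h8 : b * p ≤ b * δ := by gcongr
  nlinarith [mul_le_mul_of_nonneg_left h6 h7]

/-- The number of clusters decays at most like `1 / T`. -/
lemma IsSolution.inv_apply_zero_le (hw : IsSolution w₀ w) (hw₀ : IsProfile w₀) (hb : 0 ≤ b)
    (hs : SlopeBound b w₀) {T : ℝ} (hT : 0 < T) : (w T 0)⁻¹ ≤ (w₀ 0)⁻¹ + 2 * b * T := by
  -- One step size `T / n` serves at all times, because `w t 0 ≤ w₀ 0`.
  obtain ⟨n, hn⟩ := exists_nat_gt (2 * T * w₀ 0)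
  have hw0 : 0 < w₀ 0 := hw.initial 0 le_rfl ▸ hw.apply_zero_pos hw₀ le_rfl
  have hn0 : (0 : ℝ) < n := lt_trans (by positivity) hn
  have hδ : 0 < T / n := by positivity
  have key : ∀ k : ℕ, (w (k * (T / n)) 0)⁻¹ ≤ (w₀ 0)⁻¹ + 2 * b * (k * (T / n)) := by
    intro k
    induction k with
    | zero => simp [hw.initial 0 le_rfl]
    | succ k ih =>
      have hk : ((k + 1 : ℕ) : ℝ) * (T / n) = k * (T / n) + T / n := by push_cast; ring
      rw [hk]
      have := hw.inv_apply_zero_add_le hw₀ hb hs (t := k * (T / n)) (by positivity) hδ (by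
        rw [div_mul_eq_mul_div, div_le_iff₀ hn0]
        linarith)
      linarith
  have := key n
  rwa [mul_div_cancel₀ T hn0.ne'] at this

/-- For data with bounded beta function, the mean volume is controlled by the typical volume. -/
lemma inv_apply_zero_le_of_typicalVolume_eq_one (hw₀ : IsProfile w₀) (hb : 0 ≤ b)
    (hs : SlopeBound b w₀) (hL : typicalVolume w₀ = 1) (hmass : tailIntegral w₀ 0 = 1) :
    (w₀ 0)⁻¹ ≤ 2 * (1 + b) ^ 3 := by
  have hw0 : 0 < w₀ 0 := by
    refine (hw₀.nonneg 0 le_rfl).lt_of_ne fun h => ?_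
    simp [typicalVolume, ← h] at hL
  set I := ∫ x in Ioi (0 : ℝ), x ^ (-(2 / 3) : ℝ) * w₀ x with hI
  have hI3 : I = 3 * w₀ 0 := by
    have h1 : (1 / 3) * I / w₀ 0 = 1 :=
      (pow_eq_one_iff_of_ne_zero (by norm_num : 3 ≠ 0)).1 hL |>.resolve_right fun h => by
        exact absurd h.2 (by decide)
    rw [div_eq_one_iff_eq hw0.ne'] at h1
    linarith
  have hint : IntegrableOn (fun x : ℝ => x ^ (-(2 / 3) : ℝ) * w₀ x) (Ioi 0) := by
    by_contra h
    have : I = 0 := integral_undef h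
    linarith
  set ℓ := tailIntegral w₀ 0 / (2 * w₀ 0) with hℓ
  have hℓ0 : 0 < ℓ := by rw [hℓ, hmass]; positivity
  have hle : ∀ x ∈ Icc 0 ℓ, w₀ 0 / (1 + b) ≤ w₀ x := fun x hx =>
    hs.le hw₀.antitone hw₀.integrable hb hw0 hx.1 hx.2
  have hpow : ∫ x in (0 : ℝ)..ℓ, x ^ (-(2 / 3) : ℝ) = 3 * ℓ ^ (1 / 3 : ℝ) := by
    rw [integral_rpow (Or.inl (by norm_num))]
    norm_num
    ring
  have hlow : 3 * ℓ ^ (1 / 3 : ℝ) * (w₀ 0 / (1 + b)) ≤ I := by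
    rw [← hpow, ← intervalIntegral.integral_mul_const, intervalIntegral.integral_of_le hℓ0.le]
    have hmono : ∫ x in Ioc 0 ℓ, x ^ (-(2 / 3) : ℝ) * (w₀ 0 / (1 + b)) ≤
        ∫ x in Ioc 0 ℓ, x ^ (-(2 / 3) : ℝ) * w₀ x := by
      refine setIntegral_mono_on ?_ (hint.mono_set Ioc_subset_Ioi_self) measurableSet_Ioc
        fun x hx => ?_
      · have := (intervalIntegral.intervalIntegrable_rpow' (a := 0) (b := ℓ)
          (r := -(2 / 3)) (by norm_num)).mul_const (w₀ 0 / (1 + b))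
        exact (intervalIntegrable_iff_integrableOn_Ioc_of_le hℓ0.le).1 this
      · have := hle x ⟨hx.1.le, hx.2⟩
        have := hx.1
        gcongr
    refine hmono.trans (setIntegral_mono_set hint ?_ Ioc_subset_Ioi_self.eventuallyLE)
    filter_upwards [ae_restrict_mem measurableSet_Ioi] with x hx
    exact mul_nonneg (Real.rpow_nonneg (le_of_lt hx) _) (hw₀.nonneg x (le_of_lt hx))
  -- The factor `w₀ 0` cancels, leaving a bound on `ℓ = 1/(2 w₀ 0)`.
  have h1 : ℓ ^ (1 / 3 : ℝ) ≤ 1 + b := by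
    rw [hI3, mul_div_assoc', div_le_iff₀ (by linarith)] at hlow
    have : 3 * w₀ 0 * ℓ ^ (1 / 3 : ℝ) ≤ 3 * w₀ 0 * (1 + b) := by linarith
    exact le_of_mul_le_mul_left this (by positivity)
  have h2 : ℓ ≤ (1 + b) ^ 3 := by
    calc ℓ = (ℓ ^ (1 / 3 : ℝ)) ^ 3 := by
          rw [← Real.rpow_natCast, ← Real.rpow_mul hℓ0.le]; norm_num
      _ ≤ _ := by gcongr
  have h3 : (w₀ 0)⁻¹ = 2 * ℓ := by rw [hℓ, hmass]; field_simp
  rw [h3]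
  linarith

end

/-! ### The cluster measure -/

section

variable {v : ℝ → ℝ}

lemma monotone_neg_max (ha : AntitoneOn v (Ici 0)) : Monotone fun x => -v (max x 0) :=
  fun x y hxy => neg_le_neg (ha (le_max_right x 0) (le_max_right y 0) (max_le_max_right 0 hxy))

lemma mul_apply_le_tailIntegral (hn : ∀ x, 0 ≤ x → 0 ≤ v x) (ha : AntitoneOn v (Ici 0))
    (hi : IntegrableOn v (Ioi 0)) {x : ℝ} (hx : 0 ≤ x) : v x * x ≤ tailIntegral v 0 := by
  have h1 := le_tailIntegral_sub ha hi le_rfl hx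
  have h2 := tailIntegral_nonneg hn hx
  linarith

lemma tendsto_atTop_zero_of_integrableOn (hn : ∀ x, 0 ≤ x → 0 ≤ v x) (ha : AntitoneOn v (Ici 0))
    (hi : IntegrableOn v (Ioi 0)) : Tendsto v atTop (𝓝 0) := by
  refine squeeze_zero' (g := fun x => tailIntegral v 0 / x) ?_ ?_
    (tendsto_const_nhds.div_atTop tendsto_id)
  · filter_upwards [eventually_ge_atTop 0] with x hx using hn x hx
  · filter_upwards [eventually_gt_atTop 0] with x hx
    rw [le_div_iff₀ hx]
    exact mul_apply_le_tailIntegral hn ha hi hx.le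

lemma clusterMeasure_eq (ha : AntitoneOn v (Ici 0)) :
    clusterMeasure v = (monotone_neg_max ha).stieltjesFunction.measure :=
  dif_pos _

lemma stieltjesFunction_of_neg (ha : AntitoneOn v (Ici 0)) {x : ℝ} (hx : x < 0) :
    (monotone_neg_max ha).stieltjesFunction x = -v 0 := by
  rw [Monotone.stieltjesFunction_eq]
  refine rightLim_eq_of_tendsto ?_
  refine tendsto_const_nhds.congr' ?_
  filter_upwards [mem_nhdsWithin_of_mem_nhds (Iio_mem_nhds hx)] with y (hy : y < 0)
  rw [max_eq_right hy.le]

lemma tendsto_stieltjesFunction_atBot (ha : AntitoneOn v (Ici 0)) :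
    Tendsto (monotone_neg_max ha).stieltjesFunction atBot (𝓝 (-v 0)) := by
  refine tendsto_const_nhds.congr' ?_
  filter_upwards [eventually_lt_atBot 0] with x hx
  exact (stieltjesFunction_of_neg ha hx).symm

lemma tendsto_stieltjesFunction_atTop (hn : ∀ x, 0 ≤ x → 0 ≤ v x) (ha : AntitoneOn v (Ici 0))
    (hi : IntegrableOn v (Ioi 0)) :
    Tendsto (monotone_neg_max ha).stieltjesFunction atTop (𝓝 0) := by
  have hlim := tendsto_atTop_zero_of_integrableOn hn ha hi
  have h1 : Tendsto (fun x => -v x) atTop (𝓝 0) := by simpa using hlim.neg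
  have h2 : Tendsto (fun x => -v (x + 1)) atTop (𝓝 0) :=
    h1.comp (tendsto_atTop_add_const_right _ 1 tendsto_id)
  refine tendsto_of_tendsto_of_tendsto_of_le_of_le' h1 h2 ?_ ?_
  · filter_upwards [eventually_ge_atTop 0] with x hx
    have := (monotone_neg_max ha).le_rightLim (le_refl x)
    simpa [Monotone.stieltjesFunction_eq, max_eq_left hx] using this
  · filter_upwards [eventually_ge_atTop 0] with x hx
    have := (monotone_neg_max ha).rightLim_le (lt_add_one x)
    simpa [Monotone.stieltjesFunction_eq, max_eq_left (by linarith : (0 : ℝ) ≤ x + 1)] using this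

lemma clusterMeasure_univ (hn : ∀ x, 0 ≤ x → 0 ≤ v x) (ha : AntitoneOn v (Ici 0))
    (hi : IntegrableOn v (Ioi 0)) : clusterMeasure v univ = ENNReal.ofReal (v 0) := by
  rw [clusterMeasure_eq ha, StieltjesFunction.measure_univ _ (tendsto_stieltjesFunction_atBot ha)
    (tendsto_stieltjesFunction_atTop hn ha hi)]
  simp

lemma clusterMeasure_Iio (ha : AntitoneOn v (Ici 0)) : clusterMeasure v (Iio 0) = 0 := by
  rw [clusterMeasure_eq ha, StieltjesFunction.measure_Iio _ (tendsto_stieltjesFunction_atBot ha)]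
  have : Function.leftLim (monotone_neg_max ha).stieltjesFunction 0 = -v 0 := by
    refine leftLim_eq_of_tendsto ?_
    refine tendsto_const_nhds.congr' ?_
    filter_upwards [self_mem_nhdsWithin] with y (hy : y < 0)
    exact (stieltjesFunction_of_neg ha hy).symm
  simp [this]

/-- The Stieltjes function takes right limits, so `Ioi x` has mass `v(x+)`: at most `v x`, and at
least `v y` for every `y > x`. -/
lemma clusterMeasure_Ioi_le (hn : ∀ x, 0 ≤ x → 0 ≤ v x) (ha : AntitoneOn v (Ici 0))
    (hi : IntegrableOn v (Ioi 0)) {x : ℝ} (hx : 0 ≤ x) :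
    clusterMeasure v (Ioi x) ≤ ENNReal.ofReal (v x) := by
  rw [clusterMeasure_eq ha,
    StieltjesFunction.measure_Ioi _ (tendsto_stieltjesFunction_atTop hn ha hi)]
  have := (monotone_neg_max ha).le_rightLim (le_refl x)
  rw [max_eq_left hx] at this
  exact ENNReal.ofReal_le_ofReal (by rw [Monotone.stieltjesFunction_eq]; linarith)

lemma le_clusterMeasure_Ioi (hn : ∀ x, 0 ≤ x → 0 ≤ v x) (ha : AntitoneOn v (Ici 0))
    (hi : IntegrableOn v (Ioi 0)) {x y : ℝ} (hx : 0 ≤ x) (hxy : x < y) :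
    ENNReal.ofReal (v y) ≤ clusterMeasure v (Ioi x) := by
  rw [clusterMeasure_eq ha,
    StieltjesFunction.measure_Ioi _ (tendsto_stieltjesFunction_atTop hn ha hi)]
  have := (monotone_neg_max ha).rightLim_le hxy
  rw [max_eq_left (hx.trans hxy.le)] at this
  exact ENNReal.ofReal_le_ofReal (by rw [Monotone.stieltjesFunction_eq]; linarith)

lemma isFiniteMeasure_clusterMeasure (hn : ∀ x, 0 ≤ x → 0 ≤ v x) (ha : AntitoneOn v (Ici 0))
    (hi : IntegrableOn v (Ioi 0)) : IsFiniteMeasure (clusterMeasure v) :=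
  ⟨by rw [clusterMeasure_univ hn ha hi]; exact ENNReal.ofReal_lt_top⟩

lemma ae_nonneg_clusterMeasure (ha : AntitoneOn v (Ici 0)) :
    ∀ᵐ x ∂clusterMeasure v, 0 ≤ x := by
  rw [ae_iff]
  simp only [not_le]
  exact clusterMeasure_Iio ha

/-- Layer-cake formula. -/
lemma lintegral_clusterMeasure_le (hn : ∀ x, 0 ≤ x → 0 ≤ v x) (ha : AntitoneOn v (Ici 0))
    (hi : IntegrableOn v (Ioi 0)) :
    ∫⁻ x, ENNReal.ofReal x ∂clusterMeasure v ≤ ENNReal.ofReal (tailIntegral v 0) := by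
  rw [lintegral_eq_lintegral_meas_lt _ (ae_nonneg_clusterMeasure ha) aemeasurable_id, tailIntegral,
    ofReal_integral_eq_lintegral_ofReal hi
      ((ae_restrict_mem measurableSet_Ioi).mono fun x hx => hn x (le_of_lt hx))]
  exact setLIntegral_mono' measurableSet_Ioi fun x hx =>
    clusterMeasure_Ioi_le hn ha hi (le_of_lt hx)

lemma integrable_clusterMeasure (hn : ∀ x, 0 ≤ x → 0 ≤ v x) (ha : AntitoneOn v (Ici 0))
    (hi : IntegrableOn v (Ioi 0)) : Integrable (fun x => x) (clusterMeasure v) := by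
  refine ⟨aestronglyMeasurable_id, ?_⟩
  rw [hasFiniteIntegral_iff_ofReal (ae_nonneg_clusterMeasure ha)]
  exact (lintegral_clusterMeasure_le hn ha hi).trans_lt ENNReal.ofReal_lt_top

lemma meanVolume_le (hn : ∀ x, 0 ≤ x → 0 ≤ v x) (ha : AntitoneOn v (Ici 0))
    (hi : IntegrableOn v (Ioi 0)) : meanVolume v ≤ tailIntegral v 0 / v 0 := by
  have h0 := hn 0 le_rfl
  rw [meanVolume, measureReal_def, clusterMeasure_univ hn ha hi, ENNReal.toReal_ofReal h0,
    integral_eq_lintegral_of_nonneg_ae (ae_nonneg_clusterMeasure ha) aestronglyMeasurable_id]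
  gcongr
  exact ENNReal.toReal_le_of_le_ofReal (tailIntegral_nonneg hn le_rfl)
    (lintegral_clusterMeasure_le hn ha hi)

/-- Markov's inequality; `z^{2/3} ≤ 1 + z` supplies integrability. -/
lemma le_energy (hn : ∀ x, 0 ≤ x → 0 ≤ v x) (ha : AntitoneOn v (Ici 0))
    (hi : IntegrableOn v (Ioi 0)) {x y : ℝ} (hx : 0 ≤ x) (hxy : x < y) : x ^ (2 / 3 : ℝ) * v y ≤ energy v := by
  have := isFiniteMeasure_clusterMeasure hn ha hi
  have hae := ae_nonneg_clusterMeasure ha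
  have hint : Integrable (fun z : ℝ => z ^ (2 / 3 : ℝ)) (clusterMeasure v) := by
    refine ((integrable_const 1).add (integrable_clusterMeasure hn ha hi)).mono'
      (by fun_prop) ?_
    filter_upwards [hae] with z hz
    rw [Real.norm_of_nonneg (Real.rpow_nonneg hz _), Pi.add_apply]
    rcases le_total z 1 with h | h
    · have := Real.rpow_le_one hz h (by norm_num : (0 : ℝ) ≤ 2 / 3)
      linarith
    · have := Real.rpow_le_rpow_of_exponent_le h (by norm_num : (2 / 3 : ℝ) ≤ 1)
      rw [Real.rpow_one] at this
      linarith
  have h1 := mul_meas_ge_le_integral_of_nonneg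
    (hae.mono fun z hz => Real.rpow_nonneg hz _) hint (x ^ (2 / 3 : ℝ))
  refine le_trans ?_ h1
  have hx0 := Real.rpow_nonneg hx (2 / 3)
  gcongr
  have h2 : v y ≤ (clusterMeasure v).real (Ioi x) :=
    (ENNReal.ofReal_le_iff_le_toReal (measure_ne_top _ _)).1 (le_clusterMeasure_Ioi hn ha hi hx hxy)
  refine h2.trans (measureReal_mono fun z (hz : x < z) => ?_)
  have := hz.le
  simp only [mem_ofPred_eq]
  gcongr

end

/-- For profiles of unit mass, the slope bound controls the energy from below. -/
lemma SlopeBound.one_div_energy_pow_le {v : ℝ → ℝ} {b : ℝ} (hs : SlopeBound b v) (hb : 0 ≤ b)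
    (hn : ∀ x, 0 ≤ x → 0 ≤ v x) (ha : AntitoneOn v (Ici 0)) (hi : IntegrableOn v (Ioi 0))
    (hv : 0 < v 0) (hmass : tailIntegral v 0 = 1) :
    1 / energy v ^ 3 ≤ 16 * (1 + b) ^ 3 * (v 0)⁻¹ := by
  set y := tailIntegral v 0 / (2 * v 0) with hy
  have hy' : y = (2 * v 0)⁻¹ := by rw [hy, hmass, one_div]
  have hy0 : 0 < y := by rw [hy']; positivity
  have h1 := hs.le ha hi hb hv hy0.le le_rfl
  -- Evaluating at `y / 2` leaves the strict gap that `le_energy` requires.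
  have h2 := le_energy hn ha hi (half_pos hy0).le (half_lt_self hy0)
  have h3 : 0 < (y / 2) ^ (2 / 3 : ℝ) * (v 0 / (1 + b)) := by positivity
  have h4 : (y / 2) ^ (2 / 3 : ℝ) * (v 0 / (1 + b)) ≤ energy v := le_trans (by gcongr) h2
  have h5 : ((y / 2) ^ (2 / 3 : ℝ)) ^ 3 = (y / 2) ^ 2 := by
    rw [← Real.rpow_natCast, ← Real.rpow_mul (half_pos hy0).le, ← Real.rpow_natCast]
    norm_num
  calc 1 / energy v ^ 3 ≤ 1 / ((y / 2) ^ (2 / 3 : ℝ) * (v 0 / (1 + b))) ^ 3 := by gcongr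
    _ = 16 * (1 + b) ^ 3 * (v 0)⁻¹ := by
      rw [mul_pow, h5, hy']
      field_simp
      norm_num

end LSW

theorem proposition4p2 (βinf : ℝ) :
    ∃ C : ℝ, 0 < C ∧
      ∀ w₀ : ℝ → ℝ, LSW.IsProfile w₀ → LSW.typicalVolume w₀ = 1 → LSW.BetaBounded w₀ βinf →
        ∀ w : ℝ → ℝ → ℝ, LSW.IsSolution w₀ w →
          ∀ T : ℝ, 1 < T →
            LSW.meanVolume (w T) ≤ C * T ∧ 1 / LSW.energy (w T) ^ 3 ≤ C * T := by
  -- The slope estimates need a nonnegative constant.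
  set b := max βinf 0
  have hb : 0 ≤ b := le_max_right _ _
  set A := 2 * (1 + b) ^ 3 + 2 * b with hA
  have hA0 : 0 < A := by positivity
  have hone : 1 ≤ 16 * (1 + b) ^ 3 := by
    have : 1 ≤ (1 + b) ^ 3 := one_le_pow₀ (by linarith)
    linarith
  refine ⟨16 * (1 + b) ^ 3 * A, by positivity, fun w₀ hw₀ hL hβ w hw T hT => ?_⟩
  have hT0 : 0 ≤ T := by linarith
  have hs := hβ.slopeBound hw₀ hb (le_max_left _ _)
  have hmass : LSW.tailIntegral w₀ 0 = 1 := by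
    rw [← hw.tailIntegral_zero le_rfl]
    exact setIntegral_congr_fun measurableSet_Ioi fun x hx => (hw.initial x (le_of_lt hx)).symm
  have h1 : (w T 0)⁻¹ ≤ A * T := by
    have h2 := hw.inv_apply_zero_le hw₀ hb hs (by linarith : 0 < T)
    have h3 := LSW.inv_apply_zero_le_of_typicalVolume_eq_one hw₀ hb hs hL hmass
    -- Since `T > 1`, the initial term is absorbed into a multiple of `T`.
    have h4 : 2 * (1 + b) ^ 3 * 1 ≤ 2 * (1 + b) ^ 3 * T := by gcongr
    rw [hA, add_mul]
    linarith
  have hn := hw.nonneg hw₀ hT0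
  have ha := hw.antitoneOn hw₀ hT0
  have hi := hw.integrableOn hT0
  have hm := hw.tailIntegral_zero hT0
  rw [mul_assoc]
  constructor
  · have h2 := LSW.meanVolume_le hn ha hi
    rw [hm, one_div] at h2
    exact (h2.trans h1).trans (le_mul_of_one_le_left (by positivity) hone)
  · refine ((hw.slopeBound hw₀ hb hs hT0).one_div_energy_pow_le hb hn ha hi
      (hw.apply_zero_pos hw₀ hT0) hm).trans ?_
    gcongr
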